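/- Let $C_1,C_2,C_3$ be three circles orthogonal to the unit circle $\partial\mathbb{D}$ that bound pairwise disjoint closed discs, let $\rho_1,\rho_2,\rho_3$ be the inversions in them (hyperbolic reflections of the Poincaré disc $\mathbb{D}$), and let $\Gamma=\langle\rho_1\rho_2,\rho_1\rho_3\rangle$. Let $\delta$ be the critical exponent of $\Gamma$ and $\mu$ its Patterson–Sullivan measure seen from $0$, i.e. a probability measure on $\partial\mathbb{D}$ carried by the limit set $\Lambda_\Gamma$ with $\mu(\gamma E)=\int_E|\gamma'|^{\delta}\,d\mu$ for all $\gamma\in\Gamma$ and all Borel sets $E\subset\partial\mathbb{D}$. For $x,y\in\partial\mathbb{D}$ let $\tilde d(x,y)\in[0,2\pi)$ be the counterclockwise distance from $x$ to $y$, and let $p(x,\eta)=\mu(\{y:\tilde d(x,y)\le\eta\})/\eta^{\delta}$. For every $N$ let $P_1,\dots,P_N$ be independent random points of $\partial\mathbb{D}$ with law $\mu$, all defined on one probability space, with no assumption on how the samples for different $N$ are related. Let $d_i=\min_{j\ne i}\tilde d(P_i,P_j)$ be the length of the oriented gap starting at $P_i$ (with $d_1=2\pi$ if $N=1$), and let $\nu_N=\frac1N\sum_{i=1}^N\delta_{d_iN^{1/\delta}}$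 be the empirical distribution of the scaled gaps, where $\delta_t$ denotes the unit mass at $t$. Then for every $s\ge 0$, as $N\to\infty$, $$\operatorname{Var}\bigl(\nu_N([0,s])\bigr)\to 0,\qquad \mathbb{E}\bigl(\nu_N([0,s])\bigr)-\Bigl(1-\int_{\partial\mathbb{D}}e^{-s^{\delta}p(x,\,sN^{-1/\delta})}\,d\mu(x)\Bigr)\to 0,$$ and almost surely $$\nu_N([0,s])-\Bigl(1-\int_{\partial\mathbb{D}}e^{-s^{\delta}p(x,\,sN^{-1/\delta})}\,d\mu(x)\Bigr)\to 0 .$$ (For $s=0$ the exponent is understood to be $0$.) -/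

import Mathlib

open MeasureTheory ProbabilityTheory Filter Topology Set

noncomputable section

namespace ThinGap

/-- The closed unit disc, that is, the Poincaré disc together with its boundary circle. -/
abbrev ClosedDisc : Type := Metric.closedBall (0 : ℂ) 1

/-- The boundary circle of the Poincaré disc, with its Borel sigma-algebra. -/
abbrev Boundary : Type := Metric.sphere (0 : ℂ) 1

/-- The inclusion of the boundary circle into the closed disc. -/
def Boundary.incl (x : Boundary) : ClosedDisc := ⟨x, Metric.sphere_subset_closedBall x.2⟩

/-- The origin, as a point of the closed disc. -/
def origin : ClosedDisc := ⟨0, Metric.mem_closedBall_self zero_le_one⟩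

/-- The Euclidean radius of the circle with centre `c` that is orthogonal to the unit circle
(for `1 < ‖c‖`). -/
def orthRadius (c : ℂ) : ℝ := Real.sqrt (‖c‖ ^ 2 - 1)

theorem orthRadius_sq {c : ℂ} (hc : 1 < ‖c‖) : orthRadius c ^ 2 = ‖c‖ ^ 2 - 1 :=
  Real.sq_sqrt (by nlinarith)

theorem orthRadius_ne_zero {c : ℂ} (hc : 1 < ‖c‖) : orthRadius c ≠ 0 := by
  intro h
  have := orthRadius_sq hc
  rw [h] at this
  nlinarith

/-- Inversion in a circle orthogonal to the unit circle preserves the closed unit disc. -/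
theorem inversion_mem_closedBall {c : ℂ} (hc : 1 < ‖c‖) {z : ℂ}
    (hz : z ∈ Metric.closedBall (0 : ℂ) 1) :
    EuclideanGeometry.inversion c (orthRadius c) z ∈ Metric.closedBall (0 : ℂ) 1 := by
  rw [mem_closedBall_zero_iff] at hz ⊢
  have hzc : z ≠ c := by
    rintro rfl
    linarith
  have hd : 0 < dist z c := dist_pos.2 hzc
  have hd2 : dist z c ^ 2 = (z.re - c.re) ^ 2 + (z.im - c.im) ^ 2 := by
    rw [Complex.dist_eq, Complex.sq_norm, Complex.normSq_apply, Complex.sub_re, Complex.sub_im]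
    ring
  have hd2' : 0 < (z.re - c.re) ^ 2 + (z.im - c.im) ^ 2 := by
    rw [← hd2]
    positivity
  have hc2 : ‖c‖ ^ 2 = c.re ^ 2 + c.im ^ 2 := by
    rw [Complex.sq_norm, Complex.normSq_apply]
    ring
  have hz2 : ‖z‖ ^ 2 = z.re ^ 2 + z.im ^ 2 := by
    rw [Complex.sq_norm, Complex.normSq_apply]
    ring
  have hz1 : z.re ^ 2 + z.im ^ 2 ≤ 1 := by
    rw [← hz2]
    nlinarith [norm_nonneg z]
  have hc1 : 1 < c.re ^ 2 + c.im ^ 2 := by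
    rw [← hc2]
    nlinarith
  have hk : (orthRadius c / dist z c) ^ 2
      = (c.re ^ 2 + c.im ^ 2 - 1) / ((z.re - c.re) ^ 2 + (z.im - c.im) ^ 2) := by
    rw [div_pow, orthRadius_sq hc, hd2, hc2]
  have key : ‖EuclideanGeometry.inversion c (orthRadius c) z‖ ^ 2 ≤ 1 := by
    rw [Complex.sq_norm, Complex.normSq_apply]
    simp only [EuclideanGeometry.inversion, vsub_eq_sub, vadd_eq_add, hk, Complex.add_re,
      Complex.add_im, Complex.real_smul, Complex.re_ofReal_mul, Complex.im_ofReal_mul,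
      Complex.sub_re, Complex.sub_im]
    have e : ∀ a b q : ℝ, 0 < q → q = (z.re - a) ^ 2 + (z.im - b) ^ 2 →
        ((a ^ 2 + b ^ 2 - 1) / q * (z.re - a) + a) * ((a ^ 2 + b ^ 2 - 1) / q * (z.re - a) + a) +
        ((a ^ 2 + b ^ 2 - 1) / q * (z.im - b) + b) * ((a ^ 2 + b ^ 2 - 1) / q * (z.im - b) + b)
        = 1 - (a ^ 2 + b ^ 2 - 1) * (1 - (z.re ^ 2 + z.im ^ 2)) / q := by
      intro a b q hq h
      field_simp
      subst h
      ring
    rw [e c.re c.im _ hd2' rfl]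
    have : 0 ≤ (c.re ^ 2 + c.im ^ 2 - 1) * (1 - (z.re ^ 2 + z.im ^ 2)) /
        ((z.re - c.re) ^ 2 + (z.im - c.im) ^ 2) :=
      div_nonneg (mul_nonneg (by linarith) (by linarith)) hd2'.le
    linarith
  nlinarith [norm_nonneg (EuclideanGeometry.inversion c (orthRadius c) z)]

/-- The hyperbolic reflection of the disc (and of its boundary) in the geodesic carried by the
Euclidean circle with centre `c` orthogonal to the unit circle: the inversion in that circle. -/
def reflection (c : ℂ) (hc : 1 < ‖c‖) : Equiv.Perm ClosedDisc :=
  Function.Involutive.toPerm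
    (fun z => ⟨EuclideanGeometry.inversion c (orthRadius c) z, inversion_mem_closedBall hc z.2⟩)
    (fun z => Subtype.ext
      (EuclideanGeometry.inversion_inversion c (orthRadius_ne_zero hc) (z : ℂ)))

/-- Three circles `C 0, C 1, C 2` orthogonal to the unit circle, given by their Euclidean centres,
such that the closed discs they bound are pairwise disjoint. The part of the unit disc outside the
three discs is then the region bounded by the three geodesics; it contains the origin, and the
three reflections have Jacobian at most `1` on it. -/
structure SchottkyTriple where
  /-- The Euclidean centres of the three circles. -/
  center : Fin 3 → ℂ
  one_lt_norm : ∀ i, 1 < ‖center i‖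
  disjoint : ∀ i j, i ≠ j →
    orthRadius (center i) + orthRadius (center j) < dist (center i) (center j)

namespace SchottkyTriple

variable (S : SchottkyTriple)

/-- The three generating reflections. -/
def rho (i : Fin 3) : Equiv.Perm ClosedDisc := reflection (S.center i) (S.one_lt_norm i)

/-- The orientation-preserving index two subgroup `Γ` of the reflection group, generated by
`ρ₁ ρ₂` and `ρ₁ ρ₃` (here indexed from `0`). -/
def Gam : Subgroup (Equiv.Perm ClosedDisc) :=
  Subgroup.closure {S.rho 0 * S.rho 1, S.rho 0 * S.rho 2}

end SchottkyTriple

/-- The hyperbolic distance on the open unit disc for the metric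
`4 (dx² + dy²) / (1 - (x² + y²))²`. -/
def hypDist (z w : ℂ) : ℝ :=
  2 * Real.arsinh (dist z w / (Real.sqrt (1 - ‖z‖ ^ 2) * Real.sqrt (1 - ‖w‖ ^ 2)))

/-- The Poisson kernel `(1 - |z|²) / |x - z|²`; for an orientation-preserving isometry `γ` of the
disc and `x` on the boundary circle, `|(γ⁻¹)'(x)|` equals `poisson (γ 0) x`. -/
def poisson (z x : ℂ) : ℝ := (1 - ‖z‖ ^ 2) / ‖x - z‖ ^ 2

/-- The critical exponent of a group `G` acting on the disc: the abscissa of convergence of the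
Poincaré series `∑ exp (- t d(0, γ 0))`. -/
def criticalExponent (G : Subgroup (Equiv.Perm ClosedDisc)) : ℝ :=
  sInf {t : ℝ | 0 ≤ t ∧
    Summable fun g : G => Real.exp (-t * hypDist 0 ((g : Equiv.Perm ClosedDisc) origin : ClosedDisc))}

/-- The limit set: the points of the boundary circle at which the orbit of `0` accumulates. -/
def limitSet (G : Subgroup (Equiv.Perm ClosedDisc)) : Set Boundary :=
  {x | AccPt x.incl (𝓟 {z : ClosedDisc | ∃ g ∈ G, g origin = z})}

/-- `μ` is a Patterson-Sullivan measure of `G` (seen from the origin): a probability measure on the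
boundary circle, carried by the limit set, which is conformal of dimension the critical exponent
`δ`, that is, `d(γ_* μ)/dμ (x) = |(γ⁻¹)'(x)|^δ = poisson (γ 0) x ^ δ` for all `γ` in `G`. -/
structure IsPattersonSullivan (G : Subgroup (Equiv.Perm ClosedDisc)) (μ : Measure Boundary) :
    Prop where
  isProbabilityMeasure : IsProbabilityMeasure μ
  carried : μ (limitSet G)ᶜ = 0
  conformal : ∀ g ∈ G, ∀ E : Set Boundary, MeasurableSet E →
    μ {x | g x.incl ∈ Boundary.incl '' E} =
      ∫⁻ x in E, ENNReal.ofReal (poisson (g origin : ClosedDisc) x ^ criticalExponent G) ∂μ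

/-- The counterclockwise distance from `x` to `y` along the boundary circle, in `[0, 2π)`. -/
def ccwDist (x y : Boundary) : ℝ :=
  toIcoMod Real.two_pi_pos 0 (Complex.arg (y : ℂ) - Complex.arg (x : ℂ))

/-- The arc `L(x, η)` of the points at counterclockwise distance at most `η` from `x`. -/
def arc (x : Boundary) (η : ℝ) : Set Boundary := {y | ccwDist x y ≤ η}

/-- The length of the oriented gap that starts at the `i`-th point, `min_{j ≠ i} ccwDist (x i) (x j)`.
The way from `x i` once around back to itself counts as `2π`, which only matters if there is no
other point. -/
def gap {N : ℕ} (x : Fin N → Boundary) (i : Fin N) : ℝ :=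
  Finset.univ.inf' ⟨i, Finset.mem_univ i⟩
    fun j => if j = i then 2 * Real.pi else ccwDist (x i) (x j)

/-- The distribution of the scaled gaps of `N` points: mass `1 / N` at each `d_i * N^(1/δ)`. -/
def gapMeasure (δ : ℝ) {N : ℕ} (x : Fin N → Boundary) : Measure ℝ :=
  ∑ i, (N : ENNReal)⁻¹ • Measure.dirac (gap x i * (N : ℝ) ^ (1 / δ))

/-- The ratio `p(x, η) = μ(L(x, η)) / η^δ`. -/
def ratio (μ : Measure Boundary) (δ : ℝ) (x : Boundary) (η : ℝ) : ℝ :=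
  μ.real (arc x η) / η ^ δ

/-- The quantity `1 - ∫ exp (- s^δ p(x, s N^(-1/δ))) dμ(x)`. For `s = 0` and `δ > 0` the factor
`s^δ` vanishes, so the exponent is `0`. -/
def predictedGap (μ : Measure Boundary) (δ : ℝ) (N : ℕ) (s : ℝ) : ℝ :=
  1 - ∫ x, Real.exp (-(s ^ δ * ratio μ δ x (s * (N : ℝ) ^ (-(1 / δ))))) ∂μ

end ThinGap

end

/-! For all large `N` the scale `η = s * N ^ (-(1 / δ))` is below `2π`, and `ν_N([0,s])` is the
proportion of points followed by another point within counterclockwise distance `η`. Two independent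
facts about this proportion suffice.

Mean: given `P_i = a`, the gap at `P_i` exceeds `η` exactly when the other `N - 1` points miss `arc
a η`, so the mean is `1 - ∫ (1 - μ(arc a η)) ^ (N - 1) dμ(a)` (`integral_shortGapFraction`). Since
`s ^ δ * p(a, η) = N * μ(arc a η)`, the claim reduces to `(1 - q) ^ (N - 1)` being close to `exp (-N
q)` uniformly in `q ∈ [0, 1]` (`abs_one_sub_pow_sub_exp_le`); no regularity of `μ` is needed for `s
> 0`.

Concentration: moving one point changes the number of short gaps by at most two
(`card_hasShortGap_update_le`), so McDiarmid's inequality makes the centred proportion sub-Gaussian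
with parameter `4 / N`. Its variance is `O(1/N)` and its fourth moment `O(1/N²)`. The latter is
summable, which gives almost sure convergence however the samples for different `N` are coupled.

The Schottky group enters only through `δ > 0`, which makes the scale tend to `0`, and through the
absence of atoms, which settles `s = 0`. Both come from ping-pong: an invariant probability measure
would have to give any two of the three disjoint boundary arcs total mass at least `1`, and an atom
in the limit set can always be moved by an element of the group to a strictly heavier one. -/

noncomputable section

namespace ThinGap

/-! ### Concentration for functions of independent variables, and an exponential approximation. -/

section Concentration

variable {X : Type*} [MeasurableSpace X]

/-- Fubini with one coordinate singled out: coordinate `0` drives the induction in McDiarmid's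
inequality, a general `i` the computation of the mean gap count. -/
theorem integral_pi_succ (μ : Measure X) [IsProbabilityMeasure μ] {n : ℕ} (i : Fin (n + 1))
    {g : (Fin (n + 1) → X) → ℝ} (hg : Integrable g (Measure.pi fun _ => μ)) :
    ∫ x, g x ∂(Measure.pi fun _ => μ) =
      ∫ a, ∫ z, g (i.insertNth a z) ∂(Measure.pi fun _ => μ) ∂μ := by
  have e := (measurePreserving_piFinSuccAbove (fun _ : Fin (n + 1) => μ) i).symm
  rw [← e.integral_comp', integral_prod]
  · rfl
  · exact (e.integrable_comp_emb (MeasurableEquiv.measurableEmbedding _)).2 hg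

theorem measurable_insertNth {n : ℕ} (i : Fin (n + 1)) :
    Measurable fun p : X × (Fin n → X) => (i.insertNth p.1 p.2 : Fin (n + 1) → X) :=
  (MeasurableEquiv.piFinSuccAbove (fun _ : Fin (n + 1) => X) i).symm.measurable

theorem integrable_of_measurable_of_abs_le {μ : Measure X} [IsProbabilityMeasure μ] {f : X → ℝ}
    (hf : Measurable f) {B : ℝ} (hB : ∀ x, |f x| ≤ B) : Integrable f μ :=
  Integrable.of_bound hf.aestronglyMeasurable B (ae_of_all _ hB)

theorem abs_integral_le_of_abs_le {μ : Measure X} [IsProbabilityMeasure μ] {f : X → ℝ}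
    {B : ℝ} (hB : ∀ x, |f x| ≤ B) : |∫ x, f x ∂μ| ≤ B := by
  simpa using norm_integral_le_of_norm_le_const (μ := μ) (f := f) (ae_of_all _ hB)

/-- **McDiarmid's inequality**: a bounded function of independent variables that changes by at
most `c` when one variable changes is sub-Gaussian. -/
theorem hasSubgaussianMGF_of_bounded_differences (μ : Measure X) [IsProbabilityMeasure μ]
    (c : NNReal) {B : ℝ} (n : ℕ) (f : (Fin n → X) → ℝ) (hf : Measurable f)
    (hB : ∀ x, |f x| ≤ B) (hc : ∀ x i y, |f (Function.update x i y) - f x| ≤ c) :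
    HasSubgaussianMGF (fun x => f x - ∫ z, f z ∂(Measure.pi fun _ => μ)) (n * c ^ 2)
      (Measure.pi fun _ => μ) := by
  induction n with
  | zero =>
    have h : (fun x => f x - ∫ z, f z ∂(Measure.pi fun _ => μ)) = fun _ => 0 := by
      funext x
      have : f = fun _ => f x := by
        funext y
        rw [Subsingleton.elim y x]
      rw [this]
      simp
    rw [h]
    simp
  | succ n ih =>
    have hins : ∀ a : X, Measurable fun z : Fin n → X =>
        ((0 : Fin (n + 1)).insertNth a z : Fin (n + 1) → X) := fun a =>
      (measurable_insertNth 0).comp measurable_prodMk_left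
    set m : ℝ := ∫ z, f z ∂(Measure.pi fun _ => μ) with hm
    set h : X → ℝ := fun a => ∫ z, f ((0 : Fin (n + 1)).insertNth a z) ∂(Measure.pi fun _ => μ)
      with hh
    have hfi : Integrable f (Measure.pi fun _ => μ) := integrable_of_measurable_of_abs_le hf hB
    have hmh : m = ∫ a, h a ∂μ := integral_pi_succ μ 0 hfi
    have hhm : Measurable h := by
      have : StronglyMeasurable fun p : X × (Fin n → X) => f ((0 : Fin (n + 1)).insertNth p.1 p.2) :=
        (hf.comp (measurable_insertNth 0)).stronglyMeasurable
      exact this.integral_prod_right'.measurable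
    have hfa : ∀ a, Integrable (fun z : Fin n → X => f ((0 : Fin (n + 1)).insertNth a z))
        (Measure.pi fun _ => μ) := fun a =>
      integrable_of_measurable_of_abs_le (hf.comp (hins a)) fun z => hB _
    have hdiff : ∀ a b, |h a - h b| ≤ c := by
      intro a b
      rw [hh]
      simp only
      rw [← integral_sub (hfa a) (hfa b)]
      refine abs_integral_le_of_abs_le fun z => ?_
      have := hc ((0 : Fin (n + 1)).insertNth b z) 0 a
      simpa only [Fin.insertNth_zero', Fin.update_cons_zero] using this
    obtain ⟨x₀⟩ : Nonempty X := nonempty_of_isProbabilityMeasure μ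
    -- Hoeffding's lemma on an interval of length `2 * c` centred at a reference value `h x₀`; half
    -- the length, squared, is `c ^ 2`.
    have hsub : HasSubgaussianMGF (fun a => h a - m) (c ^ 2) μ := by
      have := hasSubgaussianMGF_of_mem_Icc (μ := μ) (X := h) (a := h x₀ - c) (b := h x₀ + c)
        hhm.aemeasurable (ae_of_all _ fun a => by
          have := abs_le.1 (hdiff a x₀)
          constructor <;> linarith)
      rw [hmh]
      convert this using 1
      have : h x₀ + (c : ℝ) - (h x₀ - c) = ((2 * c : NNReal) : ℝ) := by push_cast; ring
      rw [this, NNReal.nnnorm_eq]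
      simp
    have hbd : ∀ x, |f x - m| ≤ B + B := fun x =>
      (abs_sub _ _).trans (add_le_add (hB x) (abs_integral_le_of_abs_le hB))
    have hint : ∀ t : ℝ, Integrable (fun x => Real.exp (t * (f x - m))) (Measure.pi fun _ => μ) :=
      fun t => integrable_exp_mul_of_mem_Icc (hf.sub_const _).aemeasurable
        (ae_of_all _ fun x => abs_le.1 (hbd x))
    refine ⟨hint, fun t => ?_⟩
    rw [mgf, integral_pi_succ μ 0 (hint t)]
    -- With the first variable frozen at `a`, `f - m` splits into `f - h a`, controlled by the
    -- induction hypothesis, and the constant `h a - m`, controlled afterwards by `hsub`.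
    have hinner : ∀ a, ∫ z, Real.exp (t * (f ((0 : Fin (n + 1)).insertNth a z) - m))
        ∂(Measure.pi fun _ => μ)
        ≤ Real.exp ((n * c ^ 2 : NNReal) * t ^ 2 / 2) * Real.exp (t * (h a - m)) := by
      intro a
      have h1 := (ih (fun z => f ((0 : Fin (n + 1)).insertNth a z)) (hf.comp (hins a))
        (fun z => hB _) (fun z i y => by
          have := hc ((0 : Fin (n + 1)).insertNth a z) i.succ y
          simpa only [Fin.insertNth_zero', Fin.cons_update] using this)).mgf_le t
      have h2 : ∀ z : Fin n → X, Real.exp (t * (f ((0 : Fin (n + 1)).insertNth a z) - m)) =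
          Real.exp (t * (f ((0 : Fin (n + 1)).insertNth a z) - h a)) * Real.exp (t * (h a - m)) := by
        intro z
        rw [← Real.exp_add]
        ring_nf
      simp_rw [h2]
      rw [integral_mul_const]
      exact mul_le_mul_of_nonneg_right h1 (Real.exp_pos _).le
    calc _ ≤ ∫ a, Real.exp ((n * c ^ 2 : NNReal) * t ^ 2 / 2) * Real.exp (t * (h a - m)) ∂μ :=
          integral_mono_of_nonneg (ae_of_all _ fun a => integral_nonneg fun z => (Real.exp_pos _).le)
            ((hsub.integrable_exp_mul t).const_mul _) (ae_of_all _ hinner)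
      _ = Real.exp ((n * c ^ 2 : NNReal) * t ^ 2 / 2) * mgf (fun a => h a - m) μ t := by
          rw [integral_const_mul, mgf]
      _ ≤ Real.exp ((n * c ^ 2 : NNReal) * t ^ 2 / 2) * Real.exp ((c ^ 2 : NNReal) * t ^ 2 / 2) :=
          mul_le_mul_of_nonneg_left (hsub.mgf_le t) (Real.exp_pos _).le
      _ = _ := by
          rw [← Real.exp_add]
          congr 1
          push_cast
          ring

/-- The first three terms of the series of `2 cosh t`. It lets the moment generating function at `t`
and `-t` bound the second and fourth moments together. -/
theorem two_add_sq_add_fourth_le_exp_add_exp_neg (t : ℝ) :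
    2 + t ^ 2 + t ^ 4 / 12 ≤ Real.exp t + Real.exp (-t) := by
  have h : ∀ u : ℝ, 0 ≤ u → 2 + u ^ 2 + u ^ 4 / 12 ≤ Real.exp u + Real.exp (-u) := by
    intro u hu
    have h1 := Real.hasSum_cosh u
    have h2 := h1.summable.sum_le_tsum (Finset.range 3) (fun i _ => by rw [pow_mul]; positivity)
    rw [h1.tsum_eq, Real.cosh_eq] at h2
    simp [Finset.sum_range_succ, Nat.factorial] at h2
    linarith
  rcases le_total 0 t with h0 | h0
  · exact h t h0
  · have := h (-t) (by linarith)
    rw [neg_neg] at this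
    nlinarith [this]

/-- Second and fourth moments of a sub-Gaussian variable. -/
theorem integral_sq_add_fourth_le {Ω : Type*} [MeasurableSpace Ω] {prob : Measure Ω}
    [IsProbabilityMeasure prob] {Z : Ω → ℝ} {c : NNReal} (hc : 0 < c)
    (hZ : HasSubgaussianMGF Z c prob) :
    Integrable (fun ω => Z ω ^ 2) prob ∧ Integrable (fun ω => Z ω ^ 4) prob ∧
      ∫ ω, Z ω ^ 2 ∂prob ≤ 2 * Real.exp 1 * c ∧ ∫ ω, Z ω ^ 4 ∂prob ≤ 24 * Real.exp 1 * c ^ 2 := by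
  have hc' : (0 : ℝ) < c := hc
  have i2 : Integrable (fun ω => Z ω ^ 2) prob := (hZ.memLp 2).integrable_sq
  have i4 : Integrable (fun ω => Z ω ^ 4) prob := by
    have := (hZ.memLp 4).integrable_norm_pow (by norm_num)
    refine this.congr (ae_of_all _ fun ω => ?_)
    simp [Real.norm_eq_abs, Even.pow_abs (by decide : Even 4)]
  refine ⟨i2, i4, ?_⟩
  -- This choice turns the sub-Gaussian exponent `c * t ^ 2 / 2` into the constant `1 / 2`, bounded
  -- crudely by `1`.
  set t : ℝ := Real.sqrt (c : ℝ)⁻¹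
  have ht : t ^ 2 = (c : ℝ)⁻¹ := Real.sq_sqrt (inv_nonneg.2 hc'.le)
  have ht4 : t ^ 4 = ((c : ℝ)⁻¹) ^ 2 := by rw [← ht]; ring
  have e1 : Real.exp (c * t ^ 2 / 2) ≤ Real.exp 1 := by
    rw [ht, mul_inv_cancel₀ hc'.ne']
    exact Real.exp_le_exp.2 (by norm_num)
  have m1 := (hZ.mgf_le t).trans e1
  have m2 : mgf Z prob (-t) ≤ Real.exp 1 := (hZ.mgf_le (-t)).trans (by rwa [neg_sq])
  have key : ∫ ω, (t ^ 2 * Z ω ^ 2 + t ^ 4 / 12 * Z ω ^ 4) ∂prob ≤ 2 * Real.exp 1 := by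
    calc _ ≤ ∫ ω, (Real.exp (t * Z ω) + Real.exp (-t * Z ω)) ∂prob := by
          refine integral_mono ((i2.const_mul _).add (i4.const_mul _))
            ((hZ.integrable_exp_mul t).add (hZ.integrable_exp_mul (-t))) fun ω => ?_
          have := two_add_sq_add_fourth_le_exp_add_exp_neg (t * Z ω)
          simp only [neg_mul]
          nlinarith [this]
      _ = mgf Z prob t + mgf Z prob (-t) :=
          integral_add (hZ.integrable_exp_mul t) (hZ.integrable_exp_mul (-t))
      _ ≤ _ := by linarith
  rw [integral_add (i2.const_mul _) (i4.const_mul _), integral_const_mul, integral_const_mul, ht,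
    ht4] at key
  have p2 : 0 ≤ ∫ ω, Z ω ^ 2 ∂prob := integral_nonneg fun ω => by positivity
  have p4 : 0 ≤ ∫ ω, Z ω ^ 4 ∂prob := integral_nonneg fun ω => by positivity
  constructor
  · have : (c : ℝ)⁻¹ * ∫ ω, Z ω ^ 2 ∂prob ≤ 2 * Real.exp 1 := by
      have : 0 ≤ (c : ℝ)⁻¹ ^ 2 / 12 * ∫ ω, Z ω ^ 4 ∂prob := by positivity
      linarith
    rw [inv_mul_le_iff₀ hc'] at this
    linarith
  · have : (c : ℝ)⁻¹ ^ 2 / 12 * ∫ ω, Z ω ^ 4 ∂prob ≤ 2 * Real.exp 1 := by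
      have : 0 ≤ (c : ℝ)⁻¹ * ∫ ω, Z ω ^ 2 ∂prob := by positivity
      linarith
    have h3 := mul_le_mul_of_nonneg_left this (by positivity : (0 : ℝ) ≤ 12 * c ^ 2)
    have h4 : 12 * (c : ℝ) ^ 2 * ((c : ℝ)⁻¹ ^ 2 / 12 * ∫ ω, Z ω ^ 4 ∂prob) = ∫ ω, Z ω ^ 4 ∂prob := by
      field_simp
    linarith

/-- By Tonelli `∑ Z n ^ 4` has finite integral, so it is almost surely finite and its terms tend to
`0`. The joint law of the `Z n` plays no role. -/
theorem ae_tendsto_zero_of_summable_integral_fourth {Ω : Type*} [MeasurableSpace Ω]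
    {prob : Measure Ω} {Z : ℕ → Ω → ℝ} (hi : ∀ n, Integrable (fun ω => Z n ω ^ 4) prob)
    (hs : Summable fun n => ∫ ω, Z n ω ^ 4 ∂prob) :
    ∀ᵐ ω ∂prob, Tendsto (fun n => Z n ω) atTop (𝓝 0) := by
  have h1 : ∑' n, ∫⁻ ω, ENNReal.ofReal (Z n ω ^ 4) ∂prob ≠ ⊤ := by
    have : ∀ n, ∫⁻ ω, ENNReal.ofReal (Z n ω ^ 4) ∂prob = ENNReal.ofReal (∫ ω, Z n ω ^ 4 ∂prob) :=
      fun n => (ofReal_integral_eq_lintegral_ofReal (hi n) (ae_of_all _ fun ω => by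
        simp only [Pi.zero_apply]; positivity)).symm
    simp_rw [this]
    exact hs.tsum_ofReal_ne_top
  rw [← lintegral_tsum fun n => (hi n).aemeasurable.ennreal_ofReal] at h1
  filter_upwards [ae_lt_top' (AEMeasurable.tsum
    fun n => (hi n).aemeasurable.ennreal_ofReal) h1] with ω hω
  have h2 : Tendsto (fun n => Z n ω ^ 4) atTop (𝓝 0) := by
    have := (ENNReal.summable_toReal hω.ne).tendsto_atTop_zero
    refine this.congr fun n => ENNReal.toReal_ofReal (by positivity)
  have h3 : Tendsto (fun n => Real.sqrt (Real.sqrt (Z n ω ^ 4))) atTop (𝓝 0) := by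
    have := (Real.continuous_sqrt.comp Real.continuous_sqrt).tendsto 0
    simp only [Function.comp_apply, Real.sqrt_zero] at this
    exact this.comp h2
  refine (tendsto_zero_iff_abs_tendsto_zero _).2 (h3.congr fun n => ?_)
  have : Z n ω ^ 4 = (Z n ω ^ 2) ^ 2 := by ring
  rw [this, Real.sqrt_sq (by positivity), Real.sqrt_sq_eq_abs]
  rfl

end Concentration

/-- With `t = n q`, the errors are at most `exp (-t) * q` on one side and `exp (-t) * n q ^ 2` on
the other. Both are `O(1/n)` uniformly in `q`, since `t exp (-t)` and `t ^ 2 exp (-t)` are bounded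
by `2`. The exponents `n` and `n + 1` differ because a gap depends on the other `n` of `n + 1`
points. -/
theorem abs_one_sub_pow_sub_exp_le {q : ℝ} (h0 : 0 ≤ q) (h1 : q ≤ 1) {n : ℕ} (hn : 1 ≤ n) :
    |(1 - q) ^ n - Real.exp (-((n + 1 : ℕ) * q))| ≤ 2 / n := by
  have hn' : (1 : ℝ) ≤ n := by exact_mod_cast hn
  have hn0 : (0 : ℝ) < n := by linarith
  have hq : 0 ≤ 1 - q := by linarith
  have hu : (1 - q) ^ n ≤ Real.exp (-(n * q)) := by
    calc (1 - q) ^ n ≤ Real.exp (-q) ^ n := pow_le_pow_left₀ hq (Real.one_sub_le_exp_neg q) n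
      _ = _ := by rw [← Real.exp_nat_mul]; ring_nf
  -- Bernoulli's inequality applied to `1 - q ^ 2 ≤ (1 - q) * exp q`.
  have hl : Real.exp (-(n * q)) * (1 - n * q ^ 2) ≤ (1 - q) ^ n := by
    have a1 : 1 - q ^ 2 ≤ (1 - q) * Real.exp q := by nlinarith [Real.add_one_le_exp q]
    have a2 : 1 + n * (-(q ^ 2)) ≤ (1 + -(q ^ 2)) ^ n :=
      one_add_mul_le_pow (by nlinarith) n
    have a3 : (1 + -(q ^ 2)) ^ n ≤ ((1 - q) * Real.exp q) ^ n :=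
      pow_le_pow_left₀ (by nlinarith) (by linarith) n
    rw [mul_pow, ← Real.exp_nat_mul] at a3
    calc _ ≤ Real.exp (-(n * q)) * ((1 - q) ^ n * Real.exp (n * q)) :=
          mul_le_mul_of_nonneg_left (by linarith) (Real.exp_pos _).le
      _ = (1 - q) ^ n * (Real.exp (-(n * q)) * Real.exp (n * q)) := by ring
      _ = _ := by rw [← Real.exp_add]; simp
  set t : ℝ := n * q with ht
  have ht0 : 0 ≤ t := by positivity
  have hE : Real.exp (-((n + 1 : ℕ) * q)) = Real.exp (-t) * Real.exp (-q) := by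
    rw [← Real.exp_add, ht]
    push_cast
    ring_nf
  have hq1 : 1 - q ≤ Real.exp (-q) := Real.one_sub_le_exp_neg q
  have hq2 : Real.exp (-q) ≤ 1 := Real.exp_le_one_iff.2 (by linarith)
  have hpos := Real.exp_pos (-t)
  have hexp : (1 + t + t ^ 2 / 2) * Real.exp (-t) ≤ 1 := by
    have := Real.quadratic_le_exp_of_nonneg ht0
    calc _ ≤ Real.exp t * Real.exp (-t) := mul_le_mul_of_nonneg_right this hpos.le
      _ = 1 := by rw [← Real.exp_add]; simp
  have b1 : Real.exp (-t) * q ≤ 2 / n := by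
    rw [le_div_iff₀ hn0]
    have : Real.exp (-t) * q * n = Real.exp (-t) * t := by rw [ht]; ring
    rw [this]
    nlinarith [mul_nonneg hpos.le (sq_nonneg t)]
  have b2 : Real.exp (-t) * (n * q ^ 2) ≤ 2 / n := by
    rw [le_div_iff₀ hn0]
    have : Real.exp (-t) * (n * q ^ 2) * n = Real.exp (-t) * t ^ 2 := by rw [ht]; ring
    rw [this]
    nlinarith [mul_nonneg hpos.le ht0]
  rw [hE, abs_le]
  constructor <;> nlinarith

end ThinGap
end
noncomputable section

namespace ThinGap

/-! ### Oriented gaps on the circle: bounded differences and the mean. -/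

section Gaps

/-- Resolving the reduction modulo `2π` into two cases turns every later fact about cyclic order
into linear arithmetic on arguments. -/
theorem ccwDist_eq (x y : Boundary) :
    ccwDist x y = if Complex.arg (x : ℂ) ≤ Complex.arg (y : ℂ)
      then Complex.arg (y : ℂ) - Complex.arg (x : ℂ)
      else Complex.arg (y : ℂ) - Complex.arg (x : ℂ) + 2 * Real.pi := by
  have hx := Complex.arg_mem_Ioc (x : ℂ)
  have hy := Complex.arg_mem_Ioc (y : ℂ)
  rw [ccwDist, toIcoMod_eq_iff]
  split_ifs with h
  · exact ⟨⟨by linarith, by linarith [hx.1, hy.2]⟩, 0, by simp⟩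
  · exact ⟨⟨by linarith [hx.2, hy.1], by linarith⟩, -1, by simp⟩

theorem ccwDist_nonneg (x y : Boundary) : 0 ≤ ccwDist x y :=
  (toIcoMod_mem_Ico Real.two_pi_pos 0 _).1

theorem ccwDist_self (x : Boundary) : ccwDist x x = 0 := by simp [ccwDist_eq]

theorem arg_injective : Function.Injective fun x : Boundary => Complex.arg (x : ℂ) := by
  intro x y h
  refine Subtype.ext (Complex.ext_norm_arg ?_ h)
  rw [mem_sphere_zero_iff_norm.1 x.2, mem_sphere_zero_iff_norm.1 y.2]

theorem eq_of_ccwDist_le_zero {x y : Boundary} (h : ccwDist x y ≤ 0) : x = y := by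
  have hx := Complex.arg_mem_Ioc (x : ℂ)
  have hy := Complex.arg_mem_Ioc (y : ℂ)
  apply arg_injective
  rw [ccwDist_eq] at h
  simp only
  split_ifs at h <;> linarith [hx.1, hx.2, hy.1, hy.2]

theorem arc_zero (x : Boundary) : arc x 0 = {x} := by
  ext y
  simp only [arc, mem_ofPred_eq, mem_singleton_iff]
  exact ⟨fun h => (eq_of_ccwDist_le_zero h).symm, fun h => h ▸ (ccwDist_self _).le⟩

/-- A point `z` cannot come strictly before `b` on the way from `a` and strictly before `a` on the
way from `b`. -/
theorem ccwDist_le_of_lt {a b z : Boundary} (h : ccwDist a z < ccwDist a b) :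
    ccwDist b a ≤ ccwDist b z := by
  have ha := Complex.arg_mem_Ioc (a : ℂ)
  have hb := Complex.arg_mem_Ioc (b : ℂ)
  have hz := Complex.arg_mem_Ioc (z : ℂ)
  rw [ccwDist_eq, ccwDist_eq] at h ⊢
  split_ifs at h ⊢ <;> linarith [ha.1, ha.2, hb.1, hb.2, hz.1, hz.2]

theorem measurable_ccwDist : Measurable fun p : Boundary × Boundary => ccwDist p.1 p.2 := by
  simp_rw [ccwDist_eq]
  have h1 : Measurable fun p : Boundary × Boundary => Complex.arg (p.1 : ℂ) :=
    Complex.measurable_arg.comp (measurable_subtype_coe.comp measurable_fst)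
  have h2 : Measurable fun p : Boundary × Boundary => Complex.arg (p.2 : ℂ) :=
    Complex.measurable_arg.comp (measurable_subtype_coe.comp measurable_snd)
  exact Measurable.ite (measurableSet_le h1 h2) (h2.sub h1) ((h2.sub h1).add_const _)

theorem measurableSet_arc (x : Boundary) (η : ℝ) : MeasurableSet (arc x η) :=
  measurableSet_le (measurable_ccwDist.comp measurable_prodMk_left) measurable_const

/-- There is another point at counterclockwise distance at most `η` after the `i`-th point. -/
def HasShortGap (η : ℝ) {N : ℕ} (x : Fin N → Boundary) (i : Fin N) : Prop :=
  ∃ j, j ≠ i ∧ ccwDist (x i) (x j) ≤ η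

open Classical in
/-- The proportion of the points whose oriented gap has length at most `η`. -/
def shortGapFraction (η : ℝ) {N : ℕ} (x : Fin N → Boundary) : ℝ :=
  ((Finset.univ.filter fun i => HasShortGap η x i).card : ℝ) / N

/-- The bound `η < 2π` discards the conventional diagonal term `2π` in `gap`. -/
theorem gap_le_iff {η : ℝ} (hη : η < 2 * Real.pi) {N : ℕ} (x : Fin N → Boundary) (i : Fin N) :
    gap x i ≤ η ↔ HasShortGap η x i := by
  refine (Finset.inf'_le_iff ⟨i, Finset.mem_univ i⟩).trans (exists_congr fun j => ?_)
  by_cases h : j = i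
  · simp [h, hη]
  · simp [h]

theorem gap_nonneg {N : ℕ} (x : Fin N → Boundary) (i : Fin N) : 0 ≤ gap x i := by
  refine Finset.le_inf' _ _ fun j _ => ?_
  split_ifs
  · exact Real.two_pi_pos.le
  · exact ccwDist_nonneg _ _

theorem gapMeasure_real_Icc {δ s : ℝ} {N : ℕ} (hN : 0 < N)
    (hη : s * (N : ℝ) ^ (-(1 / δ)) < 2 * Real.pi) (x : Fin N → Boundary) :
    (gapMeasure δ x).real (Icc 0 s) = shortGapFraction (s * (N : ℝ) ^ (-(1 / δ))) x := by
  classical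
  have hN' : (0 : ℝ) < N := by exact_mod_cast hN
  have hpow : 0 < (N : ℝ) ^ (1 / δ) := Real.rpow_pos_of_pos hN' _
  have hmem : ∀ i, gap x i * (N : ℝ) ^ (1 / δ) ∈ Icc 0 s ↔
      HasShortGap (s * (N : ℝ) ^ (-(1 / δ))) x i := by
    intro i
    rw [← gap_le_iff hη, Real.rpow_neg hN'.le, ← div_eq_mul_inv, le_div_iff₀ hpow]
    exact ⟨fun h => h.2, fun h => ⟨mul_nonneg (gap_nonneg x i) hpow.le, h⟩⟩
  rw [Measure.real, gapMeasure, Measure.finsetSum_apply, shortGapFraction]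
  simp only [Measure.smul_apply, Measure.dirac_apply' _ measurableSet_Icc, indicator_apply, hmem,
    Pi.one_apply, smul_eq_mul]
  rw [← Finset.mul_sum, Finset.sum_boole, ENNReal.toReal_mul]
  simp [div_eq_inv_mul]

theorem measurableSet_hasShortGap (η : ℝ) {N : ℕ} (i : Fin N) :
    MeasurableSet {x : Fin N → Boundary | HasShortGap η x i} := by
  have : {x : Fin N → Boundary | HasShortGap η x i} =
      ⋃ j, ⋃ (_ : j ≠ i), {x | ccwDist (x i) (x j) ≤ η} := by
    ext x
    simp [HasShortGap]
  rw [this]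
  refine MeasurableSet.iUnion fun j => MeasurableSet.iUnion fun _ => ?_
  have hm : Measurable fun x : Fin N → Boundary => (x i, x j) :=
    (measurable_pi_apply i).prodMk (measurable_pi_apply j)
  exact measurableSet_le (measurable_ccwDist.comp hm) measurable_const

theorem shortGapFraction_eq_sum (η : ℝ) {N : ℕ} (x : Fin N → Boundary) :
    shortGapFraction η x = (∑ i, {x | HasShortGap η x i}.indicator (fun _ => (1 : ℝ)) x) / N := by
  classical
  simp [shortGapFraction, indicator_apply, Finset.sum_boole]

theorem measurable_shortGapFraction (η : ℝ) {N : ℕ} :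
    Measurable (shortGapFraction η : (Fin N → Boundary) → ℝ) := by
  have : (shortGapFraction η : (Fin N → Boundary) → ℝ) = fun x =>
      (∑ i, {x | HasShortGap η x i}.indicator (fun _ => (1 : ℝ)) x) / N :=
    funext fun x => shortGapFraction_eq_sum η x
  rw [this]
  exact (Finset.measurable_fun_sum _ fun i _ =>
    measurable_const.indicator (measurableSet_hasShortGap η i)).div_const _

theorem shortGapFraction_nonneg (η : ℝ) {N : ℕ} (x : Fin N → Boundary) :
    0 ≤ shortGapFraction η x := by
  unfold shortGapFraction
  positivity

theorem shortGapFraction_le_one (η : ℝ) {N : ℕ} (x : Fin N → Boundary) :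
    shortGapFraction η x ≤ 1 := by
  classical
  refine div_le_one_of_le₀ ?_ (Nat.cast_nonneg _)
  exact_mod_cast (Finset.card_filter_le _ _).trans (by simp)

theorem abs_shortGapFraction_le_one (η : ℝ) {N : ℕ} (x : Fin N → Boundary) :
    |shortGapFraction η x| ≤ 1 := by
  rw [abs_of_nonneg (shortGapFraction_nonneg η x)]
  exact shortGapFraction_le_one η x

open Classical in
/-- Moving one of the points changes the number of short gaps by at most two. -/
theorem card_hasShortGap_update_le (η : ℝ) {N : ℕ} (x : Fin N → Boundary) (k : Fin N)
    (y : Boundary) :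
    (Finset.univ.filter fun i => HasShortGap η x i).card ≤
      (Finset.univ.filter fun i => HasShortGap η (Function.update x k y) i).card + 2 := by
  -- `T` collects the points other than `k` whose gap is short because of a point other than `k`, so
  -- it survives the move; `U` collects those for which `k` is the only witness. The `2` accounts
  -- for `U` and for `k` itself.
  set T := Finset.univ.filter fun i => i ≠ k ∧ ∃ j, j ≠ i ∧ j ≠ k ∧ ccwDist (x i) (x j) ≤ η
  set U := Finset.univ.filter fun i => i ≠ k ∧ ccwDist (x i) (x k) ≤ η ∧
    ∀ j, j ≠ i → j ≠ k → η < ccwDist (x i) (x j)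
  have hT : T ⊆ Finset.univ.filter fun i => HasShortGap η (Function.update x k y) i := by
    intro i hi
    obtain ⟨hik, j, hji, hjk, hd⟩ := (Finset.mem_filter.1 hi).2
    refine Finset.mem_filter.2 ⟨Finset.mem_univ _, j, hji, ?_⟩
    rwa [Function.update_of_ne hik, Function.update_of_ne hjk]
  -- Two members `a`, `b` of `U` would both meet `k` before meeting each other, which
  -- `ccwDist_le_of_lt` forbids.
  have hU : U.card ≤ 1 := by
    refine Finset.card_le_one.2 fun a ha b hb => ?_
    by_contra hab
    obtain ⟨hak, ha1, ha2⟩ := (Finset.mem_filter.1 ha).2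
    obtain ⟨hbk, hb1, hb2⟩ := (Finset.mem_filter.1 hb).2
    have h1 := ha2 b (Ne.symm hab) hbk
    have h2 := hb2 a hab hak
    have := ccwDist_le_of_lt (ha1.trans_lt h1)
    linarith
  have hS : (Finset.univ.filter fun i => HasShortGap η x i) ⊆ insert k (T ∪ U) := by
    intro i hi
    obtain ⟨j, hji, hd⟩ := (Finset.mem_filter.1 hi).2
    by_cases hik : i = k
    · exact hik ▸ Finset.mem_insert_self _ _
    refine Finset.mem_insert_of_mem (Finset.mem_union.2 ?_)
    by_cases h : ∃ j, j ≠ i ∧ j ≠ k ∧ ccwDist (x i) (x j) ≤ η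
    · exact Or.inl (Finset.mem_filter.2 ⟨Finset.mem_univ _, hik, h⟩)
    · refine Or.inr (Finset.mem_filter.2 ⟨Finset.mem_univ _, hik, ?_, ?_⟩)
      · by_contra hk
        exact h ⟨j, hji, fun e => hk (e ▸ hd), hd⟩
      · intro j hj hjk
        by_contra hd'
        exact h ⟨j, hj, hjk, not_lt.1 hd'⟩
  calc _ ≤ (insert k (T ∪ U)).card := Finset.card_le_card hS
    _ ≤ (T ∪ U).card + 1 := Finset.card_insert_le _ _
    _ ≤ T.card + U.card + 1 := Nat.add_le_add_right (Finset.card_union_le _ _) _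
    _ ≤ _ := by
      have := Finset.card_le_card hT
      omega

theorem abs_shortGapFraction_update_sub_le (η : ℝ) {N : ℕ} (x : Fin N → Boundary) (k : Fin N)
    (y : Boundary) :
    |shortGapFraction η (Function.update x k y) - shortGapFraction η x| ≤ (2 / N : NNReal) := by
  classical
  have h1 := card_hasShortGap_update_le η x k y
  have h2 := card_hasShortGap_update_le η (Function.update x k y) k (x k)
  rw [Function.update_idem, Function.update_eq_self] at h2
  rw [shortGapFraction, shortGapFraction, ← sub_div, abs_div, Nat.abs_cast]
  push_cast
  refine div_le_div_of_nonneg_right ?_ (Nat.cast_nonneg _)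
  rw [abs_le]
  have h1' := (Nat.cast_le (α := ℝ)).2 h1
  have h2' := (Nat.cast_le (α := ℝ)).2 h2
  push_cast at h1' h2'
  constructor <;> linarith

theorem hasSubgaussianMGF_shortGapFraction (μ : Measure Boundary) [IsProbabilityMeasure μ] (η : ℝ)
    {N : ℕ} (hN : 0 < N) :
    HasSubgaussianMGF
      (fun x : Fin N → Boundary => shortGapFraction η x -
        ∫ z : Fin N → Boundary, shortGapFraction η z ∂(Measure.pi fun _ => μ)) (4 / N)
      (Measure.pi fun _ => μ) := by
  -- Differences `2 / N` in `N` variables give `N * (2 / N) ^ 2 = 4 / N`.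
  convert hasSubgaussianMGF_of_bounded_differences μ (2 / N) N (shortGapFraction η)
    (measurable_shortGapFraction η) (abs_shortGapFraction_le_one η)
    (abs_shortGapFraction_update_sub_le η) using 1
  have : (N : NNReal) ≠ 0 := by exact_mod_cast hN.ne'
  field_simp
  norm_num

theorem measurable_real_arc (μ : Measure Boundary) [IsProbabilityMeasure μ] (η : ℝ) :
    Measurable fun x => μ.real (arc x η) :=
  (measurable_measure_prodMk_left
    (measurableSet_le measurable_ccwDist measurable_const)).ennreal_toReal

theorem integral_shortGapFraction (μ : Measure Boundary) [IsProbabilityMeasure μ] (η : ℝ) (n : ℕ) :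
    ∫ x : Fin (n + 1) → Boundary, shortGapFraction η x ∂(Measure.pi fun _ => μ) =
      1 - ∫ a, (1 - μ.real (arc a η)) ^ n ∂μ := by
  have hq : Measurable fun a => (1 - μ.real (arc a η)) ^ n :=
    (measurable_const.sub (measurable_real_arc μ η)).pow_const n
  have hqi : Integrable (fun a => (1 - μ.real (arc a η)) ^ n) μ :=
    integrable_of_measurable_of_abs_le hq (B := 1) fun a => by
      have h1 := measureReal_nonneg (μ := μ) (s := arc a η)
      have h2 := measureReal_le_one (μ := μ) (s := arc a η)
      rw [abs_of_nonneg (pow_nonneg (by linarith) n)]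
      exact pow_le_one₀ (by linarith) (by linarith)
  have hi : ∀ i : Fin (n + 1), Integrable
      (fun x : Fin (n + 1) → Boundary => {x | HasShortGap η x i}.indicator (fun _ => (1 : ℝ)) x)
      (Measure.pi fun _ => μ) := fun i =>
    (integrable_const _).indicator (measurableSet_hasShortGap η i)
  have key : ∀ i : Fin (n + 1), ∫ x : Fin (n + 1) → Boundary,
      {x | HasShortGap η x i}.indicator (fun _ => (1 : ℝ)) x ∂(Measure.pi fun _ => μ) =
      1 - ∫ a, (1 - μ.real (arc a η)) ^ n ∂μ := by
    intro i
    rw [integral_pi_succ μ i (hi i)]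
    have inner : ∀ a, ∫ z : Fin n → Boundary, {x | HasShortGap η x i}.indicator
        (fun _ => (1 : ℝ)) (i.insertNth a z : Fin (n + 1) → Boundary) ∂(Measure.pi fun _ => μ) =
        1 - (1 - μ.real (arc a η)) ^ n := by
      intro a
      have hset : ∀ z : Fin n → Boundary, {x | HasShortGap η x i}.indicator
          (fun _ => (1 : ℝ)) (i.insertNth a z : Fin (n + 1) → Boundary) =
          1 - (univ.pi fun _ : Fin n => (arc a η)ᶜ).indicator (fun _ => (1 : ℝ)) z := by
        intro z
        -- With the `i`-th point at `a`, its gap is long exactly when the remaining points lie in a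
        -- product of arc complements, whose measure factorizes.
        have : (i.insertNth a z : Fin (n + 1) → Boundary) ∈ {x | HasShortGap η x i} ↔
            z ∉ univ.pi fun _ : Fin n => (arc a η)ᶜ := by
          simp only [HasShortGap, mem_ofPred_eq, Fin.insertNth_apply_same, mem_univ_pi,
            mem_compl_iff, arc, not_forall, not_not]
          constructor
          · rintro ⟨j, hj, hd⟩
            obtain ⟨k, rfl⟩ := Fin.exists_succAbove_eq hj
            exact ⟨k, by simpa using hd⟩
          · rintro ⟨k, hk⟩
            exact ⟨i.succAbove k, Fin.succAbove_ne i k, by simpa using hk⟩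
        by_cases hz : z ∈ univ.pi fun _ : Fin n => (arc a η)ᶜ
        · rw [indicator_of_notMem (fun h => this.1 h hz), indicator_of_mem hz, sub_self]
        · rw [indicator_of_mem (this.2 hz), indicator_of_notMem hz, sub_zero]
      have hms : MeasurableSet (univ.pi fun _ : Fin n => (arc a η)ᶜ) :=
        MeasurableSet.univ_pi fun _ => (measurableSet_arc a η).compl
      simp_rw [hset]
      rw [integral_sub (integrable_const _) ((integrable_const _).indicator hms),
        integral_indicator_const _ hms, Measure.real, Measure.pi_pi]
      simp only [Finset.prod_const, Finset.card_univ, Fintype.card_fin, ENNReal.toReal_pow]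
      have : (μ (arc a η)ᶜ).toReal = 1 - μ.real (arc a η) :=
        probReal_compl_eq_one_sub (measurableSet_arc a η)
      rw [this]
      simp
    simp_rw [inner]
    rw [integral_sub (integrable_const _) hqi]
    simp
  simp_rw [shortGapFraction_eq_sum]
  rw [integral_div, integral_finsetSum _ fun i _ => hi i, Finset.sum_congr rfl fun i _ => key i]
  rw [Finset.sum_const, Finset.card_univ, Fintype.card_fin, nsmul_eq_mul]
  field_simp

theorem predictedGap_zero (μ : Measure Boundary) [IsProbabilityMeasure μ] {δ : ℝ} (hδ : δ ≠ 0)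
    (N : ℕ) : predictedGap μ δ N 0 = 0 := by
  simp [predictedGap, Real.zero_rpow hδ]

/-- The scale is chosen so that `η ^ δ = s ^ δ / N`; the powers cancel and only `N * μ(arc)`
remains. -/
theorem predictedGap_of_pos (μ : Measure Boundary) {δ : ℝ} (hδ : δ ≠ 0) {N : ℕ} (hN : 0 < N)
    {s : ℝ} (hs : 0 < s) :
    predictedGap μ δ N s =
      1 - ∫ x, Real.exp (-(N * μ.real (arc x (s * (N : ℝ) ^ (-(1 / δ)))))) ∂μ := by
  have hN' : (0 : ℝ) < N := by exact_mod_cast hN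
  have h : (s * (N : ℝ) ^ (-(1 / δ))) ^ δ = s ^ δ * (N : ℝ)⁻¹ := by
    rw [Real.mul_rpow hs.le (Real.rpow_nonneg hN'.le _), ← Real.rpow_mul hN'.le]
    have : -(1 / δ) * δ = -1 := by field_simp
    rw [this, Real.rpow_neg_one]
  have hs' : s ^ δ ≠ 0 := (Real.rpow_pos_of_pos hs δ).ne'
  rw [predictedGap]
  congr 2
  funext x
  rw [ratio, h]
  congr 2
  field_simp

/-- The mean of the proportion of short gaps is asymptotic to the predicted value. -/
theorem abs_integral_shortGapFraction_sub_predictedGap_le (μ : Measure Boundary)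
    [IsProbabilityMeasure μ] [NullSingletonClass μ] {δ : ℝ} (hδ : δ ≠ 0) {s : ℝ} (hs : 0 ≤ s) {n : ℕ}
    (hn : 1 ≤ n) :
    |∫ x : Fin (n + 1) → Boundary, shortGapFraction (s * ((n + 1 : ℕ) : ℝ) ^ (-(1 / δ))) x
        ∂(Measure.pi fun _ => μ) - predictedGap μ δ (n + 1) s| ≤ 2 / n := by
  rw [integral_shortGapFraction]
  -- At `s = 0` a short gap is a coincidence of two points, and the arcs are single points; this is
  -- the only case where the absence of atoms is used.
  rcases hs.eq_or_lt with rfl | hs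
  · rw [predictedGap_zero μ hδ]
    simp only [zero_mul, arc_zero, measureReal_def, measure_singleton]
    simp
    positivity
  · rw [predictedGap_of_pos μ hδ n.succ_pos hs]
    set η := s * ((n + 1 : ℕ) : ℝ) ^ (-(1 / δ))
    have h1 : ∀ a, 0 ≤ μ.real (arc a η) := fun a => measureReal_nonneg
    have h2 : ∀ a, μ.real (arc a η) ≤ 1 := fun a => measureReal_le_one
    have i1 : Integrable (fun a => (1 - μ.real (arc a η)) ^ n) μ :=
      integrable_of_measurable_of_abs_le
        ((measurable_const.sub (measurable_real_arc μ η)).pow_const n) (B := 1) fun a => by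
          rw [abs_of_nonneg (pow_nonneg (by linarith [h2 a]) n)]
          exact pow_le_one₀ (by linarith [h2 a]) (by linarith [h1 a])
    have i2 : Integrable (fun a => Real.exp (-((n + 1 : ℕ) * μ.real (arc a η)))) μ :=
      integrable_of_measurable_of_abs_le
        (Real.measurable_exp.comp ((measurable_real_arc μ η).const_mul _).neg) (B := 1) fun a => by
          rw [abs_of_pos (Real.exp_pos _)]
          exact Real.exp_le_one_iff.2 (neg_nonpos.2 (mul_nonneg (Nat.cast_nonneg _) (h1 a)))
    rw [sub_sub_sub_cancel_left, ← integral_sub i2 i1]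
    refine abs_integral_le_of_abs_le fun a => ?_
    rw [abs_sub_comm]
    exact abs_one_sub_pow_sub_exp_le (h1 a) (h2 a) hn

end Gaps

end ThinGap
end
noncomputable section

namespace ThinGap

/-! ### Conformal factors of inversions in circles orthogonal to the unit circle. -/

section Inversion

theorem orthRadius_pos {c : ℂ} (hc : 1 < ‖c‖) : 0 < orthRadius c :=
  (Real.sqrt_nonneg _).lt_of_ne' (orthRadius_ne_zero hc)

theorem ClosedDisc.norm_le_one (z : ClosedDisc) : ‖(z : ℂ)‖ ≤ 1 := mem_closedBall_zero_iff.1 z.2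

theorem ClosedDisc.ne_of_one_lt_norm (z : ClosedDisc) {c : ℂ} (hc : 1 < ‖c‖) : (z : ℂ) ≠ c := by
  intro h
  have := z.norm_le_one
  rw [h] at this
  linarith

/-- The factor `r ^ 2 / |z - c| ^ 2` is the linear dilation of the inversion at `z`. The identity
also shows that the unit circle is preserved. -/
theorem one_sub_norm_sq_inversion {c z : ℂ} (hc : 1 < ‖c‖) (hz : z ≠ c) :
    1 - ‖EuclideanGeometry.inversion c (orthRadius c) z‖ ^ 2 =
      orthRadius c ^ 2 * (1 - ‖z‖ ^ 2) / dist z c ^ 2 := by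
  have hd : 0 < dist z c := dist_pos.2 hz
  have hd2 : dist z c ^ 2 = (z.re - c.re) ^ 2 + (z.im - c.im) ^ 2 := by
    rw [Complex.dist_eq, Complex.sq_norm, Complex.normSq_apply, Complex.sub_re, Complex.sub_im]
    ring
  have hq : 0 < (z.re - c.re) ^ 2 + (z.im - c.im) ^ 2 := by
    rw [← hd2]
    positivity
  have hk : (orthRadius c / dist z c) ^ 2
      = (c.re ^ 2 + c.im ^ 2 - 1) / ((z.re - c.re) ^ 2 + (z.im - c.im) ^ 2) := by
    rw [div_pow, orthRadius_sq hc, hd2, Complex.sq_norm, Complex.normSq_apply]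
    ring
  rw [orthRadius_sq hc, hd2, Complex.sq_norm, Complex.sq_norm, Complex.sq_norm,
    Complex.normSq_apply, Complex.normSq_apply, Complex.normSq_apply]
  simp only [EuclideanGeometry.inversion, vsub_eq_sub, vadd_eq_add, hk, Complex.add_re,
    Complex.add_im, Complex.real_smul, Complex.re_ofReal_mul, Complex.im_ofReal_mul,
    Complex.sub_re, Complex.sub_im]
  have e : ∀ a b q : ℝ, 0 < q → q = (z.re - a) ^ 2 + (z.im - b) ^ 2 →
      1 - (((a ^ 2 + b ^ 2 - 1) / q * (z.re - a) + a) * ((a ^ 2 + b ^ 2 - 1) / q * (z.re - a) + a) +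
      ((a ^ 2 + b ^ 2 - 1) / q * (z.im - b) + b) * ((a ^ 2 + b ^ 2 - 1) / q * (z.im - b) + b))
      = (a * a + b * b - 1) * (1 - (z.re * z.re + z.im * z.im)) / q := by
    intro a b q hq h
    field_simp
    subst h
    ring
  exact e c.re c.im _ hq rfl

/-- How the Poisson kernel changes under a reflection of the disc. -/
theorem poisson_inversion {c w y : ℂ} (hc : 1 < ‖c‖) (hw : w ≠ c) (hy : y ≠ c) :
    poisson (EuclideanGeometry.inversion c (orthRadius c) w) y =
      poisson w (EuclideanGeometry.inversion c (orthRadius c) y) *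
        (orthRadius c ^ 2 / dist y c ^ 2) := by
  set r := orthRadius c
  have hr : r ≠ 0 := orthRadius_ne_zero hc
  set y' := EuclideanGeometry.inversion c r y with hy'
  have hyy : EuclideanGeometry.inversion c r y' = y :=
    EuclideanGeometry.inversion_inversion c hr y
  have hdy : dist y c ≠ 0 := dist_ne_zero.2 hy
  have hdw : dist w c ≠ 0 := dist_ne_zero.2 hw
  have hy'c : y' ≠ c := by
    rw [← dist_ne_zero, hy', EuclideanGeometry.dist_inversion_center]
    positivity
  have h1 : dist y' c = r ^ 2 / dist y c := EuclideanGeometry.dist_inversion_center c y r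
  have h2 : ‖y - EuclideanGeometry.inversion c r w‖ = r ^ 2 / (dist y' c * dist w c) * ‖y' - w‖ := by
    rw [← Complex.dist_eq, ← Complex.dist_eq]
    conv_lhs => rw [← hyy]
    exact EuclideanGeometry.dist_inversion_inversion hy'c hw r
  rw [poisson, poisson, one_sub_norm_sq_inversion hc hw, h2, h1]
  -- At the pole of the kernel both sides are `0` by the convention for division by zero.
  by_cases h0 : ‖y' - w‖ = 0
  · simp [h0]
  · change r ^ 2 * (1 - ‖w‖ ^ 2) / dist w c ^ 2 / _ = _
    field_simp

theorem poisson_zero {x : ℂ} (hx : ‖x‖ = 1) : poisson 0 x = 1 := by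
  simp [poisson, hx]

end Inversion

theorem Boundary.incl_injective : Function.Injective Boundary.incl := fun _ _ h =>
  Subtype.ext (congrArg (fun z : ClosedDisc => (z : ℂ)) h)

theorem Boundary.norm_eq_one (x : Boundary) : ‖(x : ℂ)‖ = 1 := mem_sphere_zero_iff_norm.1 x.2

theorem Boundary.continuous_incl : Continuous Boundary.incl :=
  Continuous.subtype_mk continuous_subtype_val _

/-! ### Ping-pong for the reflection group and location of the limit set. -/

namespace SchottkyTriple

variable (S : SchottkyTriple)

/-- The part in the closed unit disc of the closed disc bounded by the `i`-th circle. -/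
def disc (i : Fin 3) : Set ClosedDisc :=
  {z | dist (z : ℂ) (S.center i) ≤ orthRadius (S.center i)}

theorem isClosed_disc (i : Fin 3) : IsClosed (S.disc i) :=
  isClosed_le (continuous_subtype_val.dist continuous_const) continuous_const

theorem coe_rho (i : Fin 3) (z : ClosedDisc) :
    (S.rho i z : ℂ) = EuclideanGeometry.inversion (S.center i) (orthRadius (S.center i)) z := rfl

theorem rho_rho (i : Fin 3) (z : ClosedDisc) : S.rho i (S.rho i z) = z :=
  Subtype.ext (EuclideanGeometry.inversion_inversion _ (orthRadius_ne_zero (S.one_lt_norm i)) _)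

theorem rho_mul_rho (i : Fin 3) : S.rho i * S.rho i = 1 := Equiv.ext (S.rho_rho i)

theorem rho_inv (i : Fin 3) : (S.rho i)⁻¹ = S.rho i := inv_eq_of_mul_eq_one_left (S.rho_mul_rho i)

theorem continuous_rho (i : Fin 3) : Continuous (S.rho i) := by
  refine Continuous.subtype_mk ?_ _
  exact Continuous.inversion continuous_const continuous_const continuous_subtype_val
    fun z => z.ne_of_one_lt_norm (S.one_lt_norm i)

theorem dist_rho_center (i : Fin 3) (z : ClosedDisc) :
    dist (S.rho i z : ℂ) (S.center i) =
      orthRadius (S.center i) ^ 2 / dist (z : ℂ) (S.center i) :=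
  EuclideanGeometry.dist_inversion_center _ _ _

theorem dist_center_pos (i : Fin 3) (z : ClosedDisc) : 0 < dist (z : ℂ) (S.center i) :=
  dist_pos.2 (z.ne_of_one_lt_norm (S.one_lt_norm i))

theorem dist_rho_center_lt {i : Fin 3} {z : ClosedDisc} (hz : z ∉ S.disc i) :
    dist (S.rho i z : ℂ) (S.center i) < orthRadius (S.center i) := by
  have hr := orthRadius_pos (S.one_lt_norm i)
  have h : orthRadius (S.center i) < dist (z : ℂ) (S.center i) := not_le.1 hz
  rw [dist_rho_center, div_lt_iff₀ (S.dist_center_pos i z)]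
  nlinarith

theorem rho_mem_disc {i : Fin 3} {z : ClosedDisc} (hz : z ∉ S.disc i) : S.rho i z ∈ S.disc i :=
  (S.dist_rho_center_lt hz).le

theorem notMem_disc_of_mem {i j : Fin 3} (hij : i ≠ j) {z : ClosedDisc} (hz : z ∈ S.disc j) :
    z ∉ S.disc i := by
  intro hi
  have h1 := S.disjoint i j hij
  have h2 := dist_triangle_left (S.center i) (S.center j) (z : ℂ)
  have hi' : dist (z : ℂ) (S.center i) ≤ orthRadius (S.center i) := hi
  have hj' : dist (z : ℂ) (S.center j) ≤ orthRadius (S.center j) := hz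
  linarith

theorem origin_notMem_disc (i : Fin 3) : origin ∉ S.disc i := by
  intro h
  have h' : dist (0 : ℂ) (S.center i) ≤ orthRadius (S.center i) := h
  rw [dist_zero_left] at h'
  have := orthRadius_sq (S.one_lt_norm i)
  nlinarith [orthRadius_pos (S.one_lt_norm i), S.one_lt_norm i]

theorem norm_rho_eq_one (i : Fin 3) {z : ClosedDisc} (hz : ‖(z : ℂ)‖ = 1) :
    ‖(S.rho i z : ℂ)‖ = 1 := by
  have := one_sub_norm_sq_inversion (S.one_lt_norm i) (z.ne_of_one_lt_norm (S.one_lt_norm i))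
  rw [← coe_rho, hz] at this
  have h2 : ‖(S.rho i z : ℂ)‖ ^ 2 = 1 ^ 2 := by
    simp only [one_pow, sub_self, mul_zero, zero_div] at this
    linarith
  exact (sq_eq_sq₀ (norm_nonneg _) zero_le_one).1 h2

/-- The action of the `i`-th reflection on the boundary circle. -/
def rhoBoundary (i : Fin 3) (x : Boundary) : Boundary :=
  ⟨S.rho i x.incl, mem_sphere_zero_iff_norm.2 (S.norm_rho_eq_one i x.norm_eq_one)⟩

theorem incl_rhoBoundary (i : Fin 3) (x : Boundary) :
    (S.rhoBoundary i x).incl = S.rho i x.incl := rfl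

theorem rho_mul_rho_mem_Gam (i j : Fin 3) : S.rho i * S.rho j ∈ S.Gam := by
  have h0 : ∀ k, S.rho 0 * S.rho k ∈ S.Gam := by
    intro k
    fin_cases k
    · simp [rho_mul_rho, one_mem]
    · exact Subgroup.subset_closure (by simp)
    · exact Subgroup.subset_closure (by simp)
  have : S.rho i * S.rho j = (S.rho 0 * S.rho i)⁻¹ * (S.rho 0 * S.rho j) := by
    rw [mul_inv_rev, rho_inv, rho_inv, mul_assoc, ← mul_assoc (S.rho 0), rho_mul_rho, one_mul]
  rw [this]
  exact mul_mem (inv_mem (h0 i)) (h0 j)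

section Words

/-- The product of the reflections along a word. -/
def word (l : List (Fin 3)) : Equiv.Perm ClosedDisc := (l.map S.rho).prod

theorem word_cons (i : Fin 3) (l : List (Fin 3)) : S.word (i :: l) = S.rho i * S.word l := by
  simp [word]

/-- The new letter either cancels an equal first letter or is prepended, so the length changes by
one and its parity flips. -/
theorem exists_reduced_rho_mul_word (i : Fin 3) {l : List (Fin 3)} (hl : l.IsChain (· ≠ ·)) :
    ∃ l' : List (Fin 3), l'.IsChain (· ≠ ·) ∧ S.word l' = S.rho i * S.word l ∧
      (Even l'.length ↔ ¬ Even l.length) := by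
  cases l with
  | nil => exact ⟨[i], by simp, S.word_cons i [], by simp⟩
  | cons j t =>
    by_cases hij : i = j
    · subst hij
      refine ⟨t, hl.tail, ?_, by simp [Nat.even_add_one]⟩
      rw [word_cons, ← mul_assoc, rho_mul_rho, one_mul]
    · exact ⟨i :: j :: t, List.isChain_cons_cons.2 ⟨hij, hl⟩, S.word_cons i _,
        by simp [Nat.even_add_one]⟩

theorem exists_reduced_even_word {g : Equiv.Perm ClosedDisc} (hg : g ∈ S.Gam) :
    ∃ l : List (Fin 3), l.IsChain (· ≠ ·) ∧ S.word l = g ∧ Even l.length := by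
  have step : ∀ i j : Fin 3, ∀ y : Equiv.Perm ClosedDisc,
      (∃ l : List (Fin 3), l.IsChain (· ≠ ·) ∧ S.word l = y ∧ Even l.length) →
      ∃ l : List (Fin 3), l.IsChain (· ≠ ·) ∧ S.word l = S.rho i * S.rho j * y ∧
        Even l.length := by
    rintro i j y ⟨l, hl, rfl, he⟩
    obtain ⟨l₁, h₁, e₁, p₁⟩ := S.exists_reduced_rho_mul_word j hl
    obtain ⟨l₂, h₂, e₂, p₂⟩ := S.exists_reduced_rho_mul_word i h₁
    exact ⟨l₂, h₂, by rw [e₂, e₁, mul_assoc], p₂.2 fun h => p₁.1 h he⟩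
  induction hg using Subgroup.closure_induction_left with
  | one => exact ⟨[], by simp, by simp [word], by simp⟩
  | mul_left x hx y hy ih =>
    rcases hx with rfl | rfl <;> exact step _ _ _ ih
  | inv_mul_cancel x hx y hy ih =>
    rcases hx with rfl | rfl <;> rw [mul_inv_rev, rho_inv, rho_inv] <;> exact step _ _ _ ih

/-- Ping-pong: the origin lies outside all the discs, and each reflection sends the complement of
its disc, hence the other two discs, into its own. -/
theorem word_cons_origin_mem_disc (i : Fin 3) (l : List (Fin 3)) (hl : (i :: l).IsChain (· ≠ ·)) :
    S.word (i :: l) origin ∈ S.disc i := by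
  induction l generalizing i with
  | nil =>
    rw [word_cons]
    exact S.rho_mem_disc (by simpa [word] using S.origin_notMem_disc i)
  | cons j t ih =>
    have h := List.isChain_cons_cons.1 hl
    rw [word_cons]
    exact S.rho_mem_disc (S.notMem_disc_of_mem h.1 (ih j h.2))

/-- The union of the second generation discs, the images of the `j`-th disc under the `i`-th
reflection for `i ≠ j`. -/
def secondDiscs : Set ClosedDisc :=
  ⋃ i, ⋃ j, ⋃ (_ : i ≠ j), S.rho i ⁻¹' S.disc j

theorem mem_secondDiscs {z : ClosedDisc} :
    z ∈ S.secondDiscs ↔ ∃ i j, i ≠ j ∧ S.rho i z ∈ S.disc j := by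
  simp only [secondDiscs, mem_iUnion, mem_preimage, exists_prop]

theorem isClosed_secondDiscs : IsClosed S.secondDiscs :=
  isClosed_iUnion_of_finite fun i => isClosed_iUnion_of_finite fun j =>
    isClosed_iUnion_of_finite fun _ =>
      (S.isClosed_disc j).preimage (S.continuous_rho i)

/-- Elements of `Γ` are even words, so a nonempty reduced one has at least two letters `i ≠ j`, and
undoing the first lands in the disc of the second. The second generation is needed because only
there is the dilation in `one_lt_poisson_of_mem` strictly above `1`; as a finite union of closed
sets it also contains the limit set. -/
theorem orbit_subset :
    {z : ClosedDisc | ∃ g ∈ S.Gam, g origin = z} ⊆ {origin} ∪ S.secondDiscs := by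
  rintro z ⟨g, hg, rfl⟩
  obtain ⟨l, hl, rfl, he⟩ := S.exists_reduced_even_word hg
  match l, hl, he with
  | [], _, _ => exact Or.inl (by simp [word])
  | [i], _, he => simp at he
  | i :: j :: t, hl, _ =>
    have h := List.isChain_cons_cons.1 hl
    refine Or.inr (S.mem_secondDiscs.2 ⟨i, j, h.1, ?_⟩)
    rw [word_cons, Equiv.Perm.mul_apply, rho_rho]
    exact S.word_cons_origin_mem_disc j t h.2

theorem incl_mem_secondDiscs_of_mem_limitSet {x : Boundary} (hx : x ∈ limitSet S.Gam) :
    x.incl ∈ S.secondDiscs := by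
  have h1 : x.incl ∈ closure {z : ClosedDisc | ∃ g ∈ S.Gam, g origin = z} :=
    mem_closure_iff_clusterPt.2 (AccPt.clusterPt hx)
  have h2 := closure_minimal S.orbit_subset (isClosed_singleton.union S.isClosed_secondDiscs) h1
  refine h2.resolve_left fun h => ?_
  have : (x : ℂ) = 0 := congrArg (fun z : ClosedDisc => (z : ℂ)) h
  have hn := x.norm_eq_one
  rw [this, norm_zero] at hn
  exact zero_ne_one hn

end Words

/-- The kernel is the dilation at `x` of the inverse `ρ_j ρ_i`, and the chain rule splits it into
two reflections. The point `x` is strictly inside disc `i`, giving a factor above `1`, and `ρ_i x`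
is in disc `j`, giving a factor at least `1`. -/
theorem one_lt_poisson_of_mem {i j : Fin 3} (hij : i ≠ j) {x : Boundary}
    (hj : S.rho i x.incl ∈ S.disc j) :
    1 < poisson ((S.rho i * S.rho j) origin : ClosedDisc) x := by
  have hxn : ‖(x.incl : ℂ)‖ = 1 := x.norm_eq_one
  have key : poisson ((S.rho i * S.rho j) origin : ClosedDisc) x =
      orthRadius (S.center j) ^ 2 / dist (S.rho i x.incl : ℂ) (S.center j) ^ 2 *
        (orthRadius (S.center i) ^ 2 / dist (x : ℂ) (S.center i) ^ 2) := by
    have hxc : (x : ℂ) ≠ S.center i := x.incl.ne_of_one_lt_norm (S.one_lt_norm i)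
    rw [Equiv.Perm.mul_apply, coe_rho, poisson_inversion (S.one_lt_norm i)
      (ClosedDisc.ne_of_one_lt_norm _ (S.one_lt_norm i)) hxc]
    congr 1
    change poisson (S.rho j origin) (S.rho i x.incl) = _
    rw [coe_rho S j, poisson_inversion (S.one_lt_norm j)
      (ClosedDisc.ne_of_one_lt_norm _ (S.one_lt_norm j))
      (ClosedDisc.ne_of_one_lt_norm _ (S.one_lt_norm j)), ← coe_rho]
    have : poisson origin (S.rho j (S.rho i x.incl)) = 1 :=
      poisson_zero (S.norm_rho_eq_one j (S.norm_rho_eq_one i hxn))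
    rw [this, one_mul]
  rw [key]
  have hdi : 0 < dist (x : ℂ) (S.center i) := S.dist_center_pos i x.incl
  have hdj := S.dist_center_pos j (S.rho i x.incl)
  have hi' : dist (x : ℂ) (S.center i) < orthRadius (S.center i) := by
    have h := S.dist_rho_center_lt (S.notMem_disc_of_mem hij hj)
    rwa [rho_rho] at h
  have hj' : dist (S.rho i x.incl : ℂ) (S.center j) ≤ orthRadius (S.center j) := hj
  refine one_lt_mul_of_le_of_lt ?_ ?_
  · rw [one_le_div (by positivity)]
    exact pow_le_pow_left₀ hdj.le hj' 2
  · rw [one_lt_div (by positivity)]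
    exact pow_lt_pow_left₀ hi' hdi.le two_ne_zero

end SchottkyTriple

/-! ### Positivity of the critical exponent and absence of atoms. -/

namespace IsPattersonSullivan

variable {S : SchottkyTriple} {μ : Measure Boundary}

/-- A probability measure on the circle cannot be invariant under a Schottky group. -/
theorem criticalExponent_ne_zero (hμ : IsPattersonSullivan S.Gam μ) :
    criticalExponent S.Gam ≠ 0 := by
  intro h0
  have := hμ.isProbabilityMeasure
  set A : Fin 3 → Set Boundary := fun i => Boundary.incl ⁻¹' S.disc i
  have hA : ∀ i, MeasurableSet (A i) := fun i =>
    ((S.isClosed_disc i).preimage Boundary.continuous_incl).measurableSet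
  -- Exponent `0` would make `μ` invariant, while `ρ_i ρ_j` maps the complement of `A j` into `A i`.
  -- Summing over the three pairs gives `3 ≤ 2 * (total mass of the disjoint sets)`, which is at
  -- most `2`.
  have hpair : ∀ i j, i ≠ j → 1 ≤ μ.real (A i) + μ.real (A j) := by
    intro i j hij
    have h1 := hμ.conformal _ (S.rho_mul_rho_mem_Gam i j) (A i) (hA i)
    simp only [h0, Real.rpow_zero, ENNReal.ofReal_one, lintegral_one, Measure.restrict_apply_univ]
      at h1
    have h2 : (A j)ᶜ ⊆ {x | (S.rho i * S.rho j) x.incl ∈ Boundary.incl '' A i} := by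
      intro x hx
      exact ⟨S.rhoBoundary i (S.rhoBoundary j x),
        S.rho_mem_disc (S.notMem_disc_of_mem hij (S.rho_mem_disc hx)), rfl⟩
    have h3 : μ.real (A j)ᶜ ≤ μ.real (A i) := by
      rw [measureReal_def, measureReal_def, ← h1]
      exact ENNReal.toReal_mono (measure_ne_top _ _) (measure_mono h2)
    rw [probReal_compl_eq_one_sub (hA j)] at h3
    linarith
  have hdisj : ∀ i j, i ≠ j → Disjoint (A i) (A j) := fun i j hij =>
    disjoint_left.2 fun x hi hj => S.notMem_disc_of_mem hij hj hi
  have h01 := measureReal_union (μ := μ) (hdisj 0 1 (by decide)) (hA 1)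
  have h012 := measureReal_union (μ := μ) (s₁ := A 0 ∪ A 1) (s₂ := A 2)
    (disjoint_union_left.2 ⟨hdisj 0 2 (by decide), hdisj 1 2 (by decide)⟩) (hA 2)
  have hle := measureReal_le_one (μ := μ) (s := A 0 ∪ A 1 ∪ A 2)
  linarith [hpair 0 1 (by decide), hpair 0 2 (by decide), hpair 1 2 (by decide)]

/-- No estimate of the Poincaré series is needed: the real `sInf` is nonnegative, and the value `0`,
including the default for an empty set, is excluded by conformality. -/
theorem criticalExponent_pos (hμ : IsPattersonSullivan S.Gam μ) : 0 < criticalExponent S.Gam :=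
  lt_of_le_of_ne (Real.sInf_nonneg fun _ ht => ht.1) hμ.criticalExponent_ne_zero.symm

/-- Conformality on a singleton: moving an atom by `ρ_j ρ_i` multiplies its mass by the dilation to
the power `δ`, which exceeds `1`. -/
theorem exists_measure_singleton_lt (hμ : IsPattersonSullivan S.Gam μ) {x : Boundary}
    (hx : μ {x} ≠ 0) : ∃ y, μ {x} < μ {y} := by
  have := hμ.isProbabilityMeasure
  have hlim : x ∈ limitSet S.Gam := by
    by_contra h
    exact hx (measure_mono_null (singleton_subset_iff.2 h) hμ.carried)
  obtain ⟨i, j, hij, hj⟩ := S.mem_secondDiscs.1 (S.incl_mem_secondDiscs_of_mem_limitSet hlim)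
  have hp := Real.one_lt_rpow (S.one_lt_poisson_of_mem hij hj) hμ.criticalExponent_pos
  have hc := hμ.conformal _ (S.rho_mul_rho_mem_Gam i j) {x} (measurableSet_singleton x)
  rw [lintegral_singleton] at hc
  refine ⟨S.rhoBoundary j (S.rhoBoundary i x), ?_⟩
  calc μ {x} = 1 * μ {x} := (one_mul _).symm
    _ < ENNReal.ofReal (poisson ((S.rho i * S.rho j) origin : ClosedDisc) x ^
          criticalExponent S.Gam) * μ {x} :=
        ENNReal.mul_lt_mul_left hx (measure_ne_top _ _)
          (by rwa [← ENNReal.ofReal_one, ENNReal.ofReal_lt_ofReal_iff (by linarith)])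
    _ = _ := hc.symm
    _ ≤ _ := measure_mono ?_
  rintro y ⟨x', hx', hy⟩
  rw [mem_singleton_iff] at hx' ⊢
  subst hx'
  apply Boundary.incl_injective
  rw [S.incl_rhoBoundary, S.incl_rhoBoundary, hy, Equiv.Perm.mul_apply, S.rho_rho, S.rho_rho]

/-- A Patterson-Sullivan measure of a Schottky group has no atoms. -/
theorem nullSingletonClass (hμ : IsPattersonSullivan S.Gam μ) : NullSingletonClass μ := by
  have := hμ.isProbabilityMeasure
  refine ⟨fun a => ?_⟩
  by_contra ha
  -- Only finitely many points can be this heavy, so a heaviest atom would exist, against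
  -- `exists_measure_singleton_lt`.
  have hfin : {x | μ {a} ≤ μ {x}}.Finite :=
    Measure.finite_const_le_meas_of_disjoint_iUnion μ (As := fun x : Boundary => {x})
      (pos_iff_ne_zero.2 ha) (fun x => measurableSet_singleton x)
      (fun x y hxy => disjoint_singleton.2 hxy) (measure_ne_top _ _)
  obtain ⟨x, hx, hmax⟩ := exists_max_image _ (fun x => μ {x}) hfin ⟨a, le_refl (μ {a})⟩
  have hx' : μ {a} ≤ μ {x} := hx
  obtain ⟨y, hy⟩ := hμ.exists_measure_singleton_lt
    (x := x) ((pos_iff_ne_zero.2 ha).trans_le hx').ne'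
  exact absurd (hmax y (hx'.trans hy.le)) (not_le.2 hy)

end IsPattersonSullivan

end ThinGap
end
noncomputable section

namespace ThinGap

/-! ### Transfer to random samples and the main theorem. -/

section Samples

variable {Ω : Type*} [MeasurableSpace Ω] {prob : Measure Ω} [IsProbabilityMeasure prob]
  {μ : Measure Boundary}

theorem measurePreserving_sample {N : ℕ} {P : Fin N → Ω → Boundary} (hmeas : ∀ i, Measurable (P i))
    (hlaw : ∀ i, Measure.map (P i) prob = μ) (hindep : iIndepFun P prob) :
    MeasurePreserving (fun ω i => P i ω) prob (Measure.pi fun _ => μ) := by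
  refine ⟨measurable_pi_lambda _ hmeas, ?_⟩
  rw [(iIndepFun_iff_map_fun_eq_pi_map fun i => (hmeas i).aemeasurable).1 hindep]
  simp_rw [hlaw]

/-- The moment bounds for the proportion of short gaps of a sample. -/
theorem moments_shortGapFraction_sample [IsProbabilityMeasure μ] {N : ℕ} (hN : 0 < N) {P : Fin N → Ω → Boundary}
    (hmeas : ∀ i, Measurable (P i)) (hlaw : ∀ i, Measure.map (P i) prob = μ)
    (hindep : iIndepFun P prob) (η : ℝ) :
    let Z := fun ω => shortGapFraction η (fun i => P i ω) -
      ∫ ω, shortGapFraction η (fun i => P i ω) ∂prob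
    Integrable (fun ω => Z ω ^ 4) prob ∧ ∫ ω, Z ω ^ 4 ∂prob ≤ 384 * Real.exp 1 * (1 / (N : ℝ) ^ 2) ∧
      variance (fun ω => shortGapFraction η (fun i => P i ω)) prob ≤ 8 * Real.exp 1 / N := by
  intro Z
  have hP := measurePreserving_sample hmeas hlaw hindep
  have hm : Measurable fun ω => shortGapFraction η (fun i => P i ω) :=
    (measurable_shortGapFraction η).comp hP.measurable
  have hmean : ∫ z : Fin N → Boundary, shortGapFraction η z ∂(Measure.pi fun _ => μ) =
      ∫ ω, shortGapFraction η (fun i => P i ω) ∂prob := by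
    rw [← hP.map_eq, integral_map hP.measurable.aemeasurable
      (measurable_shortGapFraction η).aestronglyMeasurable]
  have hsub := hasSubgaussianMGF_shortGapFraction μ η hN
  rw [hmean, ← hP.map_eq] at hsub
  have hZ : HasSubgaussianMGF Z (4 / N) prob :=
    HasSubgaussianMGF.of_map hP.measurable.aemeasurable hsub
  have hc : (0 : NNReal) < 4 / N := div_pos (by norm_num) (by exact_mod_cast hN)
  obtain ⟨-, i4, h2, h4⟩ := integral_sq_add_fourth_le hc hZ
  push_cast at h2 h4
  refine ⟨i4, h4.trans_eq (by ring), ?_⟩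
  rw [variance_eq_integral hm.aemeasurable]
  exact h2.trans_eq (by ring)

end Samples

theorem eventually_scale_lt {δ : ℝ} (hδ : 0 < δ) (s : ℝ) :
    ∀ᶠ N : ℕ in atTop, s * (N : ℝ) ^ (-(1 / δ)) < 2 * Real.pi := by
  have h : Tendsto (fun N : ℕ => s * (N : ℝ) ^ (-(1 / δ))) atTop (𝓝 (s * 0)) :=
    ((tendsto_rpow_neg_atTop (one_div_pos.2 hδ)).comp tendsto_natCast_atTop_atTop).const_mul s
  rw [mul_zero] at h
  exact h.eventually_lt_const Real.two_pi_pos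

end ThinGap
end

theorem theoremA1
    (S : ThinGap.SchottkyTriple)
    (μ : Measure ThinGap.Boundary)
    (hμ : ThinGap.IsPattersonSullivan S.Gam μ)
    {Ω : Type*} [MeasurableSpace Ω] (prob : Measure Ω) [IsProbabilityMeasure prob]
    (P : (N : ℕ) → Fin N → Ω → ThinGap.Boundary)
    (hmeas : ∀ N i, Measurable (P N i))
    (hlaw : ∀ N i, Measure.map (P N i) prob = μ)
    (hindep : ∀ N, iIndepFun (P N) prob)
    (δ : ℝ) (hδ : δ = ThinGap.criticalExponent S.Gam)
    (s : ℝ) (hs : 0 ≤ s) :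
    Tendsto
        (fun N : ℕ =>
          variance (fun ω => (ThinGap.gapMeasure δ (fun i => P N i ω)).real (Icc 0 s)) prob)
        atTop (𝓝 0) ∧
      Tendsto
        (fun N : ℕ =>
          (∫ ω, (ThinGap.gapMeasure δ (fun i => P N i ω)).real (Icc 0 s) ∂prob)
            - ThinGap.predictedGap μ δ N s)
        atTop (𝓝 0) ∧
      ∀ᵐ ω ∂prob,
        Tendsto
          (fun N : ℕ =>
            (ThinGap.gapMeasure δ (fun i => P N i ω)).real (Icc 0 s)
              - ThinGap.predictedGap μ δ N s)
          atTop (𝓝 0) := by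
  have hδ0 : 0 < δ := hδ ▸ hμ.criticalExponent_pos
  have := hμ.isProbabilityMeasure
  have := hμ.nullSingletonClass
  set η : ℕ → ℝ := fun N => s * (N : ℝ) ^ (-(1 / δ)) with hη
  set F : (N : ℕ) → Ω → ℝ := fun N ω => ThinGap.shortGapFraction (η N) (fun i => P N i ω) with hF
  -- The identification needs `η N < 2π`, hence only large `N`; this is where `δ > 0` makes the
  -- scale shrink.
  have hev : ∀ᶠ N : ℕ in atTop,
      (fun ω => (ThinGap.gapMeasure δ (fun i => P N i ω)).real (Icc 0 s)) = F N := by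
    filter_upwards [ThinGap.eventually_scale_lt hδ0 s, eventually_gt_atTop 0] with N h1 h2
    exact funext fun ω => ThinGap.gapMeasure_real_Icc h2 h1 _
  have hmom : ∀ N : ℕ, 0 < N → _ := fun N hN =>
    ThinGap.moments_shortGapFraction_sample hN (hmeas N) (hlaw N) (hindep N) (η N)
  have hmean : Tendsto (fun N => ∫ ω, F N ω ∂prob - ThinGap.predictedGap μ δ N s) atTop (𝓝 0) := by
    rw [← tendsto_add_atTop_iff_nat 1]
    refine squeeze_zero_norm' ?_ (tendsto_const_div_atTop_nhds_zero_nat 2)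
    filter_upwards [eventually_ge_atTop 1] with n hn
    have hP := ThinGap.measurePreserving_sample (hmeas (n + 1)) (hlaw (n + 1)) (hindep (n + 1))
    have h := ThinGap.abs_integral_shortGapFraction_sub_predictedGap_le μ hδ0.ne' hs hn
    rw [← hP.map_eq, integral_map hP.measurable.aemeasurable
      (ThinGap.measurable_shortGapFraction _).aestronglyMeasurable] at h
    exact h
  refine ⟨?_, ?_, ?_⟩
  · have hvar : Tendsto (fun N => variance (F N) prob) atTop (𝓝 0) := by
      refine squeeze_zero' (Eventually.of_forall fun N => variance_nonneg _ _) ?_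
        (tendsto_const_div_atTop_nhds_zero_nat (8 * Real.exp 1))
      filter_upwards [eventually_gt_atTop 0] with N hN using (hmom N hN).2.2
    exact hvar.congr' (hev.mono fun N h => by simp only [h])
  · exact hmean.congr' (hev.mono fun N h => by rw [← h])
  -- The shift to `N + 1` avoids the empty sample, for which the moment bound is not available; the
  -- fourth moments are then dominated by a multiple of `1 / (N + 1) ^ 2`.
  · have hsum : Summable fun N : ℕ =>
        ∫ ω, (F (N + 1) ω - ∫ ω, F (N + 1) ω ∂prob) ^ 4 ∂prob := by
      refine Summable.of_nonneg_of_le (fun N => integral_nonneg fun ω => by positivity)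
        (fun N => (hmom (N + 1) N.succ_pos).2.1) ?_
      exact ((summable_nat_add_iff 1).2
        (Real.summable_one_div_nat_pow.2 one_lt_two)).mul_left _
    filter_upwards [ThinGap.ae_tendsto_zero_of_summable_integral_fourth
      (fun N => (hmom (N + 1) N.succ_pos).1) hsum] with ω hω
    have h1 : Tendsto (fun N => F N ω - ∫ ω, F N ω ∂prob) atTop (𝓝 0) :=
      (tendsto_add_atTop_iff_nat 1).1 hω
    have h2 := h1.add hmean
    rw [add_zero] at h2
    refine h2.congr' (hev.mono fun N h => ?_)
    have h' : (ThinGap.gapMeasure δ (fun i => P N i ω)).real (Icc 0 s) = F N ω := congrFun h ω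
    simp only [h']
    ring
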